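/- Let $u\in C^1([0,1],\ell^2(\mathbb{Z}))$ be a complex-valued solution of the discrete free Schrödinger equation $$\partial_t u(t,n)=i\bigl(u(t,n+1)+u(t,n-1)-2u(t,n)\bigr),\qquad t\in[0,1],\ n\in\mathbb{Z},$$ and suppose that for some constant $C>0$ $$|u(0,n)|,\ |u(1,n)|\le C\,\frac{1}{\sqrt{|n|}}\left(\frac{e}{2|n|}\right)^{|n|}\qquad\text{for all } n\in\mathbb{Z}\setminus\{0\}.$$ If, in addition, $$|u(0,n)|\left(\frac{2|n|}{e}\right)^{|n|}\sqrt{|n|}=o(1)$$ as $n\to+\infty$ or as $n\to-\infty$ (one of the two directions suffices), then $u(t,n)=0$ for all $t\in[0,1]$ and all $n\in\mathbb{Z}$. -/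

import Mathlib

open Filter Asymptotics
open scoped Topology

/-- The Hilbert space of square-summable complex sequences indexed by the integers. -/
abbrev EllTwoZ : Type := lp (fun _ : ℤ => ℂ) 2

/-- The discrete Laplacian on complex sequences indexed by the integers. -/
def discreteLaplacian (f : ℤ → ℂ) (n : ℤ) : ℂ :=
  f (n + 1) + f (n - 1) - 2 * f n

/-- `u` restricted to `[0,1]` is of class `C^1` with values in `ℓ²(ℤ)` (one-sided derivatives at the
endpoints) and satisfies the free equation `∂ₜ u = i Δ u` at every time in `[0,1]`; the derivative is
the one in the norm of `ℓ²(ℤ)`, and the equality of sequences is written out entry by entry. -/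
structure IsFreeSchrodingerSolution (u : ℝ → EllTwoZ) : Prop where
  contDiffOn : ContDiffOn ℝ 1 u (Set.Icc 0 1)
  equation : ∀ t ∈ Set.Icc (0 : ℝ) 1, ∀ n : ℤ,
    (derivWithin u (Set.Icc 0 1) t) n = Complex.I * discreteLaplacian (u t) n

/-! By Stirling, the hypotheses say that `u 0` and `u 1` are `O(1 / (2 ^ |n| |n|!))`. Hence the
generating functions `f_t(z) = ∑ u(t,n) z ^ n`, `t = 0, 1`, are holomorphic on `ℂ \ {0}` and of size
`exp(|z| / 2)` at infinity, and the equation gives `f_1 = exp(i(z + 1/z - 2)) f_0`.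

Let `g = exp(i(z + 1/z) / 2) f_0`. Up to a unimodular constant, also `g = exp(-i(z + 1/z) / 2) f_1`.
Using the first form in the upper half-plane and the second in the lower one gives `|g| = O(exp((|z|
- |Im z|) / 2))`. A bootstrapped Phragmén–Lindelöf argument
(`norm_le_of_norm_le_exp_norm_sub_abs_im`) turns this into boundedness at infinity. The reflection
`z ↦ 1/z` handles the origin, and Liouville makes `g` a constant `c`
(`exists_exp_mul_laurentSum_eq`).

Thus `f_0 = c exp(-i(z + 1/z) / 2)`, the generating function of `c (-i) ^ n J_n(1)`, which decays
exactly at the critical rate. The `o(1)` condition makes `f_0(iy) = o(exp(y / 2))` (after reflection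
if it holds at `-∞`), which forces `c = 0`. -/

/-! ### Phragmén–Lindelöf bootstrap in the half-plane. -/

section PhragmenLindelof

open Complex

/-- A pointwise exponential bound, in the form of a growth condition of order one. -/
lemma exists_isBigO_exp_rpow_of_norm_le {s : Set ℂ} {h : ℂ → ℂ} {M B : ℝ}
    (hh : ∀ z ∈ s, ‖h z‖ ≤ M * Real.exp (B * ‖z‖)) :
    ∃ c < (2 : ℝ), ∃ B : ℝ,
      h =O[Bornology.cobounded ℂ ⊓ 𝓟 s] fun z => Real.exp (B * ‖z‖ ^ c) := by
  refine ⟨1, by norm_num, B, IsBigO.of_bound M ?_⟩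
  refine (eventually_principal.2 fun z hz => ?_).filter_mono inf_le_right
  simpa [Real.norm_eq_abs, abs_of_pos (Real.exp_pos _)] using hh z hz

variable {g : ℂ → ℂ} {M : ℝ}

/-- Exponential growth along the positive real axis controls the growth in the half-plane. -/
lemma norm_le_exp_mul_re_of_real_axis (hd : DiffContOnCl ℂ g {z | 0 < z.re})
    (hg : ∀ z : ℂ, 0 ≤ z.re → ‖g z‖ ≤ M * Real.exp ((‖z‖ - |z.im|) / 2))
    {κ : ℝ} (hκ : ∀ x : ℝ, 0 ≤ x → ‖g x‖ ≤ M * Real.exp (κ * x)) {z : ℂ} (hz : 0 ≤ z.re) :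
    ‖g z‖ ≤ M * Real.exp (κ * z.re) := by
  have hM : 0 ≤ M := by simpa using (norm_nonneg _).trans (hg 0 (by simp))
  have hn (w : ℂ) : ‖g w * exp (-(κ * w))‖ = ‖g w‖ * Real.exp (-(κ * w.re)) := by
    simp [norm_exp]
  have key : ‖g z * exp (-(κ * z))‖ ≤ M := by
    refine PhragmenLindelof.right_half_plane_of_bounded_on_real
      (f := fun w => g w * exp (-(κ * w))) ?_ ?_ ?_ ?_ hz
    · exact hd.smul (Differentiable.diffContOnCl (by fun_prop))
    · refine exists_isBigO_exp_rpow_of_norm_le (M := M) (B := 1 / 2 + |κ|) fun w hw => ?_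
      have hw : 0 < w.re := hw
      rw [hn]
      refine (mul_le_mul_of_nonneg_right (hg w hw.le) (Real.exp_pos _).le).trans ?_
      rw [mul_assoc, ← Real.exp_add]
      gcongr
      have h1 : -κ * w.re ≤ |κ| * ‖w‖ :=
        mul_le_mul (neg_le_abs κ) (re_le_norm w) hw.le (abs_nonneg κ)
      nlinarith [abs_nonneg w.im]
    · refine ⟨M, eventually_map.2 ((eventually_ge_atTop 0).mono fun x hx => ?_)⟩
      simp only [hn, ofReal_re]
      refine (mul_le_mul_of_nonneg_right (hκ x hx) (Real.exp_pos _).le).trans ?_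
      rw [mul_assoc, ← Real.exp_add]; simp
    -- On the imaginary axis `‖z‖ = |z.im|`, so the growth bound is just `M`.
    · intro x
      rw [hn]
      simpa using hg (x * I) (by simp)
  rw [hn, Real.exp_neg, ← div_eq_mul_inv, div_le_iff₀ (Real.exp_pos _)] at key
  exact key

/-- The improved growth rate on the real axis, from the quadrant bounded by the rays through
`s - i c` and `c + i s`. -/
lemma norm_le_exp_on_real_axis_improved (hd : DiffContOnCl ℂ g {z | 0 < z.re})
    (hg : ∀ z : ℂ, 0 ≤ z.re → ‖g z‖ ≤ M * Real.exp ((‖z‖ - |z.im|) / 2))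
    {κ : ℝ} (hκ : ∀ x : ℝ, 0 ≤ x → ‖g x‖ ≤ M * Real.exp (κ * x))
    {c s : ℝ} (hc : 0 < c) (hs : 0 < s) (hcs : s ^ 2 + c ^ 2 = 1) {x : ℝ} (hx : 0 ≤ x) :
    ‖g x‖ ≤ M * Real.exp ((κ * s ^ 2 + c * (1 - s) / 2) * x) := by
  have hM : 0 ≤ M := by simpa using (norm_nonneg _).trans (hg 0 (by simp))
  set ω : ℂ := ⟨s, -c⟩ with hω
  -- `Re (μ w) = κ s Re w + (1 - s) / 2 * Im w` matches the growth rates of `g (ω * w)` on the two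
  -- sides of the quadrant.
  set μ : ℂ := ⟨κ * s, -((1 - s) / 2)⟩ with hμ
  have hωn : ‖ω‖ = 1 := by
    rw [Complex.norm_def, normSq_mk, Real.sqrt_eq_one]; nlinarith
  have hre (w : ℂ) : (ω * w).re = s * w.re + c * w.im := by simp [hω]
  have him (w : ℂ) : (ω * w).im = s * w.im - c * w.re := by simp [hω]; ring
  have hn (w : ℂ) : ‖g (ω * w) * exp (-(μ * w))‖
      = ‖g (ω * w)‖ * Real.exp (-(κ * s * w.re + (1 - s) / 2 * w.im)) := by
    simp [norm_exp, hμ]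
  have hmaps : Set.MapsTo (fun w => ω * w) (Set.Ioi 0 ×ℂ Set.Ioi 0) {z | 0 < z.re} := by
    rintro w ⟨h1, h2⟩
    have h1 : 0 < w.re := h1
    have h2 : 0 < w.im := h2
    simp only [Set.mem_ofPred_eq, hre]
    positivity
  set z : ℂ := x * ⟨s, c⟩ with hz
  have hzre : z.re = x * s := by simp [hz]
  have hzim : z.im = x * c := by simp [hz]
  have hωz : ω * z = x := by
    apply Complex.ext
    · rw [hre, hzre, hzim, ofReal_re]; linear_combination x * hcs
    · rw [him, hzre, hzim, ofReal_im]; ring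
  have key : ‖g (ω * z) * exp (-(μ * z))‖ ≤ M := by
    refine PhragmenLindelof.quadrant_I
      (f := fun w => g (ω * w) * exp (-(μ * w))) ?_ ?_ ?_ ?_
      (by rw [hzre]; positivity) (by rw [hzim]; positivity)
    · exact (hd.comp (Differentiable.diffContOnCl (by fun_prop)) hmaps).smul
        (Differentiable.diffContOnCl (by fun_prop))
    · refine exists_isBigO_exp_rpow_of_norm_le (M := M) (B := 1 / 2 + ‖μ‖) fun w hw => ?_
      have hw' : 0 < (ω * w).re := hmaps hw
      rw [norm_mul, norm_exp]
      refine (mul_le_mul_of_nonneg_right (hg _ hw'.le) (Real.exp_pos _).le).trans ?_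
      rw [mul_assoc, ← Real.exp_add]
      gcongr
      have h1 : (-(μ * w)).re ≤ ‖μ‖ * ‖w‖ := by
        simpa using re_le_norm (-(μ * w))
      rw [norm_mul ω, hωn]
      nlinarith [abs_nonneg (ω * w).im]
    · intro y hy
      rw [hn]
      refine (mul_le_mul_of_nonneg_right (norm_le_exp_mul_re_of_real_axis hd hg hκ
        (by rw [hre]; simp; positivity)) (Real.exp_pos _).le).trans ?_
      rw [mul_assoc, ← Real.exp_add, hre]
      simp [mul_assoc]
    · intro y hy
      rw [hn]
      refine (mul_le_mul_of_nonneg_right (hg _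
        (by rw [hre]; simp; positivity)) (Real.exp_pos _).le).trans ?_
      rw [mul_assoc, ← Real.exp_add, norm_mul, hωn, him]
      simp only [norm_mul, norm_real, Real.norm_eq_abs, norm_I, re_ofReal_mul, I_re, im_ofReal_mul,
        I_im, mul_one, mul_zero, one_mul, sub_zero, abs_mul, abs_of_pos hs, abs_of_nonneg hy]
      rw [show (y - s * y) / 2 + -(0 + (1 - s) / 2 * y) = 0 by ring, Real.exp_zero, mul_one]
  rw [hn, hωz, Real.exp_neg, ← div_eq_mul_inv, div_le_iff₀ (Real.exp_pos _), hzre, hzim] at key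
  refine key.trans_eq ?_
  ring_nf

/-- A function of exponential type in the right half-plane, of size `exp ((|z| - |Im z|) / 2)`, is
bounded there. -/
theorem norm_le_of_norm_le_exp_norm_sub_abs_im (hd : DiffContOnCl ℂ g {z | 0 < z.re})
    (hg : ∀ z : ℂ, 0 ≤ z.re → ‖g z‖ ≤ M * Real.exp ((‖z‖ - |z.im|) / 2))
    {z : ℂ} (hz : 0 ≤ z.re) : ‖g z‖ ≤ M := by
  -- The least admissible rate on the real axis is attained; were it positive, a small rotation
  -- would improve it.
  set S : Set ℝ := {κ | 0 ≤ κ ∧ ∀ x : ℝ, 0 ≤ x → ‖g x‖ ≤ M * Real.exp (κ * x)} with hS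
  have hSc : IsClosed S := by
    simp only [hS, Set.ofPred_and, Set.ofPred_forall]
    refine isClosed_Ici.inter (isClosed_iInter fun x => isClosed_iInter fun _ => ?_)
    exact isClosed_le (by fun_prop) (by fun_prop)
  have hSn : S.Nonempty := by
    refine ⟨1 / 2, by norm_num, fun x hx => ?_⟩
    simpa [abs_of_nonneg hx, div_eq_inv_mul] using hg x (by simpa)
  have hSb : BddBelow S := ⟨0, fun κ hκ => hκ.1⟩
  obtain ⟨h0, hκ⟩ := hSc.csInf_mem hSn hSb
  set κ := sInf S
  have hκ0 : κ = 0 := by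
    by_contra hne
    have hpos : 0 < κ := lt_of_le_of_ne h0 (Ne.symm hne)
    -- `t` is the tangent of half the rotation angle. As `1 - s = t c` and `s² = 1 - c²`, the new
    -- rate is `κ - c² (κ - t / 2)`, smaller than `κ` once `t < 2κ`; `t < 1` keeps `s > 0`.
    set t : ℝ := κ / (1 + κ) with ht
    have ht0 : 0 < t := by positivity
    have ht1 : t < 1 := by rw [ht, div_lt_one (by positivity)]; linarith
    have htκ : t ≤ κ := div_le_self h0 (by linarith)
    have hs0 : 0 < (1 - t ^ 2) / (1 + t ^ 2) := div_pos (by nlinarith) (by positivity)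
    have hc0 : 0 < 2 * t / (1 + t ^ 2) := by positivity
    have hcs : ((1 - t ^ 2) / (1 + t ^ 2)) ^ 2 + (2 * t / (1 + t ^ 2)) ^ 2 = 1 := by
      field_simp; ring
    set s := (1 - t ^ 2) / (1 + t ^ 2) with hs
    set c := 2 * t / (1 + t ^ 2) with hc
    have h1s : 1 - s = t * c := by rw [hs, hc]; field_simp; ring
    have hmem : κ * s ^ 2 + c * (1 - s) / 2 ∈ S := by
      refine ⟨?_, fun x hx => norm_le_exp_on_real_axis_improved hd hg hκ hc0 hs0 hcs hx⟩
      rw [h1s]; positivity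
    have hle : κ ≤ κ * s ^ 2 + c * (1 - s) / 2 := csInf_le hSb hmem
    rw [h1s] at hle
    have : 0 < c ^ 2 * (κ - t / 2) := mul_pos (by positivity) (by linarith)
    nlinarith
  simpa [hκ0] using norm_le_exp_mul_re_of_real_axis hd hg hκ hz

end PhragmenLindelof

/-! ### The unitary group and its Taylor series. -/

section Propagator

lemma memℓp_two_comp_add (f : EllTwoZ) (k : ℤ) :
    Memℓp (E := fun _ : ℤ => ℂ) (fun n => f (n + k)) 2 := by
  have h : Summable fun n => ‖f n‖ ^ (2 : ENNReal).toReal :=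
    (lp.memℓp f).summable (by norm_num)
  have h' : Summable fun n => ‖f (n + k)‖ ^ (2 : ENNReal).toReal :=
    h.comp_injective (add_left_injective k)
  exact memℓp_gen h'

/-- Translation by `k` on `ℓ²(ℤ)`. -/
noncomputable def shiftCLM (k : ℤ) : EllTwoZ →L[ℂ] EllTwoZ :=
  LinearMap.mkContinuous
    { toFun := fun f => ⟨fun n => f (n + k), memℓp_two_comp_add f k⟩
      map_add' := fun _ _ => rfl
      map_smul' := fun _ _ => rfl } 1 fun f => by
    rw [one_mul, lp.norm_eq_tsum_rpow (by norm_num), lp.norm_eq_tsum_rpow (by norm_num)]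
    have h : ∑' n, ‖f (n + k)‖ ^ (2 : ENNReal).toReal = ∑' n, ‖f n‖ ^ (2 : ENNReal).toReal :=
      (Equiv.addRight k).tsum_eq fun n => ‖f n‖ ^ (2 : ENNReal).toReal
    exact (congrArg (fun x : ℝ => x ^ (1 / (2 : ENNReal).toReal)) h).le

/-- The discrete Laplacian as a bounded operator on `ℓ²(ℤ)`. -/
noncomputable def laplacianCLM : EllTwoZ →L[ℂ] EllTwoZ :=
  shiftCLM 1 + shiftCLM (-1) - (2 : ℂ) • ContinuousLinearMap.id ℂ EllTwoZ

lemma laplacianCLM_apply (f : EllTwoZ) (n : ℤ) : laplacianCLM f n = discreteLaplacian f n := by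
  rfl

lemma laplacianCLM_pow_apply (k : ℕ) (f : EllTwoZ) :
    ⇑((laplacianCLM ^ k) f) = discreteLaplacian^[k] f := by
  induction k with
  | zero => simp
  | succ k ih =>
    rw [pow_succ', Function.iterate_succ_apply', ← ih]
    exact funext fun n => laplacianCLM_apply _ n

namespace IsFreeSchrodingerSolution

variable {u : ℝ → EllTwoZ}

lemma hasDerivWithinAt (hu : IsFreeSchrodingerSolution u) {t : ℝ} (ht : t ∈ Set.Icc (0 : ℝ) 1) :
    HasDerivWithinAt u ((Complex.I • laplacianCLM) (u t)) (Set.Icc 0 1) t := by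
  have h := (hu.contDiffOn.differentiableOn one_ne_zero t ht).hasDerivWithinAt
  have heq : derivWithin u (Set.Icc 0 1) t = (Complex.I • laplacianCLM) (u t) := by
    ext n
    rw [hu.equation t ht n, ← laplacianCLM_apply]
    rfl
  rwa [heq] at h

/-- A solution is the unitary group applied to its initial value. -/
theorem eq_exp_apply (hu : IsFreeSchrodingerSolution u) {t : ℝ} (ht : t ∈ Set.Icc (0 : ℝ) 1) :
    u t = NormedSpace.exp (t • (Complex.I • laplacianCLM)) (u 0) := by
  set A : EllTwoZ →L[ℂ] EllTwoZ := Complex.I • laplacianCLM with hA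
  have hexp (s : ℝ) : HasDerivAt (fun r : ℝ => NormedSpace.exp ((t - r) • A))
      (-(NormedSpace.exp ((t - s) • A) * A)) s := by
    have h := (hasDerivAt_exp_smul_const (𝕂 := ℝ) A (t - s)).scomp s
      ((hasDerivAt_id s).const_sub t)
    simpa using! h
  -- Pulling `u r` forward to time `t` gives a path with zero derivative; its values at `r = 0` and
  -- `r = t` are the two sides.
  have hw (s : ℝ) (hs : s ∈ Set.Icc (0 : ℝ) 1) :
      HasDerivWithinAt (fun r => NormedSpace.exp ((t - r) • A) (u r)) 0 (Set.Icc 0 1) s := by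
    have hc : HasDerivAt (fun r : ℝ =>
        (NormedSpace.exp ((t - r) • A)).restrictScalars ℝ)
        ((-(NormedSpace.exp ((t - s) • A) * A)).restrictScalars ℝ) s :=
      (ContinuousLinearMap.restrictScalarsL ℂ EllTwoZ EllTwoZ ℝ ℝ).hasFDerivAt.comp_hasDerivAt s
        (hexp s)
    have h := hc.hasDerivWithinAt.clm_apply (hu.hasDerivWithinAt hs)
    have hz : ((-(NormedSpace.exp ((t - s) • A) * A)).restrictScalars ℝ) (u s)
        + ((NormedSpace.exp ((t - s) • A)).restrictScalars ℝ) (A (u s)) = 0 :=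
      neg_add_cancel (NormedSpace.exp ((t - s) • A) (A (u s)))
    rw [hz] at h
    exact h
  have h := constant_of_derivWithin_zero (fun s hs => (hw s hs).differentiableWithinAt)
    (fun s hs => (hw s (Set.Ico_subset_Icc_self hs)).derivWithin
      (uniqueDiffOn_Icc_zero_one s (Set.Ico_subset_Icc_self hs))) t ht
  simpa using h

/-- The Taylor expansion in time of the entries of a solution. -/
theorem hasSum_apply (hu : IsFreeSchrodingerSolution u) (n : ℤ) :
    HasSum (fun k : ℕ => Complex.I ^ k / (k.factorial : ℂ) * discreteLaplacian^[k] (u 0) n)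
      (u 1 n) := by
  have h := NormedSpace.exp_series_hasSum_exp' (𝕂 := ℂ) (Complex.I • laplacianCLM)
  simp only [smul_pow] at h
  have h2 := (lp.evalCLM ℂ (fun _ : ℤ => ℂ) 2 n).hasSum
    ((ContinuousLinearMap.apply ℂ EllTwoZ (u 0)).hasSum h)
  have h1 := hu.eq_exp_apply (t := 1) (by simp)
  rw [one_smul] at h1
  rw [h1]
  have hk : (fun k : ℕ => Complex.I ^ k / (k.factorial : ℂ) * discreteLaplacian^[k] (u 0) n)
      = fun k : ℕ =>
        (k.factorial : ℂ)⁻¹ * (Complex.I ^ k * (laplacianCLM ^ k) (u 0) n) := by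
    funext k
    rw [← laplacianCLM_pow_apply]
    ring
  rw [hk]
  exact h2

end IsFreeSchrodingerSolution

end Propagator

/-! ### Generating functions and factorial decay. -/

section LaurentSum

open scoped Nat

/-- The sum of the bilateral series with coefficients `a` at the point `z`. -/
noncomputable def laurentSum (a : ℤ → ℂ) (z : ℂ) : ℂ := ∑' n : ℤ, a n * z ^ n

lemma laurentSum_comp_neg (a : ℤ → ℂ) (z : ℂ) :
    laurentSum (fun n => a (-n)) z = laurentSum a z⁻¹ := by
  rw [laurentSum, laurentSum, ← (Equiv.neg ℤ).tsum_eq]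
  simp

section Laplacian

variable {a : ℤ → ℂ} {z : ℂ}

lemma discreteLaplacian_mul_zpow (a : ℤ → ℂ) (hz : z ≠ 0) (n : ℤ) :
    discreteLaplacian a n * z ^ n =
      z⁻¹ * (a (n + 1) * z ^ (n + 1)) + z * (a (n - 1) * z ^ (n - 1)) - 2 * (a n * z ^ n) := by
  rw [discreteLaplacian, zpow_add_one₀ hz, zpow_sub_one₀ hz]
  field_simp

lemma summable_norm_discreteLaplacian_mul_zpow (hz : z ≠ 0)
    (ha : Summable fun n : ℤ => ‖a n * z ^ n‖) :
    (Summable fun n : ℤ => ‖discreteLaplacian a n * z ^ n‖) ∧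
      ∑' n : ℤ, ‖discreteLaplacian a n * z ^ n‖ ≤
        (‖z‖⁻¹ + ‖z‖ + 2) * ∑' n : ℤ, ‖a n * z ^ n‖ := by
  have h1 := ((Equiv.addRight (1 : ℤ)).hasSum_iff.2 ha.hasSum).mul_left ‖z‖⁻¹
  have h2 := ((Equiv.subRight (1 : ℤ)).hasSum_iff.2 ha.hasSum).mul_left ‖z‖
  have h3 := (h1.add h2).add (ha.hasSum.mul_left 2)
  have hle (n : ℤ) : ‖discreteLaplacian a n * z ^ n‖ ≤
      ‖z‖⁻¹ * ‖a (n + 1) * z ^ (n + 1)‖ + ‖z‖ * ‖a (n - 1) * z ^ (n - 1)‖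
        + 2 * ‖a n * z ^ n‖ := by
    rw [discreteLaplacian_mul_zpow a hz]
    refine (norm_sub_le _ _).trans (add_le_add ((norm_add_le _ _).trans_eq ?_) ?_)
    · rw [norm_mul z⁻¹, norm_mul z, norm_inv]
    · rw [norm_mul 2, Complex.norm_two]
  have hs := Summable.of_nonneg_of_le (fun n => norm_nonneg _) hle h3.summable
  exact ⟨hs, (hs.tsum_le_tsum hle h3.summable).trans_eq (h3.tsum_eq.trans (by ring))⟩

lemma laurentSum_discreteLaplacian (hz : z ≠ 0) (ha : Summable fun n : ℤ => ‖a n * z ^ n‖) :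
    laurentSum (discreteLaplacian a) z = (z + z⁻¹ - 2) * laurentSum a z := by
  have h1 := ((Equiv.addRight (1 : ℤ)).hasSum_iff.2 ha.of_norm.hasSum).mul_left z⁻¹
  have h2 := ((Equiv.subRight (1 : ℤ)).hasSum_iff.2 ha.of_norm.hasSum).mul_left z
  have h3 := (h1.add h2).sub (ha.of_norm.hasSum.mul_left 2)
  rw [laurentSum, laurentSum, tsum_congr (discreteLaplacian_mul_zpow a hz)]
  exact h3.tsum_eq.trans (by ring)

lemma summable_norm_iterate_discreteLaplacian_mul_zpow (hz : z ≠ 0)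
    (ha : Summable fun n : ℤ => ‖a n * z ^ n‖) (k : ℕ) :
    (Summable fun n : ℤ => ‖discreteLaplacian^[k] a n * z ^ n‖) ∧
      ∑' n : ℤ, ‖discreteLaplacian^[k] a n * z ^ n‖ ≤
        (‖z‖⁻¹ + ‖z‖ + 2) ^ k * ∑' n : ℤ, ‖a n * z ^ n‖ ∧
      laurentSum (discreteLaplacian^[k] a) z = (z + z⁻¹ - 2) ^ k * laurentSum a z := by
  induction k with
  | zero => simpa using ha
  | succ k ih =>
    obtain ⟨hs, hle, heq⟩ := ih
    have h := summable_norm_discreteLaplacian_mul_zpow hz hs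
    simp only [Function.iterate_succ_apply']
    refine ⟨h.1, h.2.trans ?_, ?_⟩
    · rw [pow_succ', mul_assoc]
      gcongr
    · rw [laurentSum_discreteLaplacian hz hs, heq]; ring

/-- The free evolution acts on generating functions as multiplication by an exponential. -/
theorem laurentSum_eq_exp_mul {b : ℤ → ℂ}
    (hb : ∀ n, HasSum (fun k : ℕ => Complex.I ^ k / (k ! : ℂ) * discreteLaplacian^[k] a n) (b n))
    (hz : z ≠ 0) (ha : Summable fun n : ℤ => ‖a n * z ^ n‖) :
    laurentSum b z = Complex.exp (Complex.I * (z + z⁻¹ - 2)) * laurentSum a z := by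
  have hit := summable_norm_iterate_discreteLaplacian_mul_zpow hz ha
  set F : ℕ → ℤ → ℂ := fun k n =>
    Complex.I ^ k / (k ! : ℂ) * (discreteLaplacian^[k] a n * z ^ n) with hF
  have hFn (k : ℕ) (n : ℤ) :
      ‖F k n‖ = (k ! : ℝ)⁻¹ * ‖discreteLaplacian^[k] a n * z ^ n‖ := by
    rw [hF, norm_mul (Complex.I ^ k / _)]; simp
  -- Absolute summability of the double series, dominated by an exponential series in `k`, permits
  -- exchanging the sums over `n` and `k`.
  have hFs : Summable (Function.uncurry F) := by
    refine Summable.of_norm ((summable_prod_of_nonneg fun _ => norm_nonneg _).2 ⟨fun k => ?_, ?_⟩)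
    · simp only [Function.uncurry_apply_pair, hFn]
      exact (hit k).1.mul_left _
    · simp only [Function.uncurry_apply_pair, hFn, tsum_mul_left]
      refine Summable.of_nonneg_of_le
        (fun k => mul_nonneg (by positivity) (tsum_nonneg fun _ => norm_nonneg _))
        (fun k => mul_le_mul_of_nonneg_left (hit k).2.1 (by positivity)) ?_
      simpa [div_eq_inv_mul, mul_assoc] using
        (Real.summable_pow_div_factorial (‖z‖⁻¹ + ‖z‖ + 2)).mul_right
          (∑' n : ℤ, ‖a n * z ^ n‖)
  calc laurentSum b z = ∑' (n : ℤ) (k : ℕ), F k n :=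
        tsum_congr fun n => by
          rw [← (hb n).tsum_eq, ← tsum_mul_right]
          exact tsum_congr fun k => by rw [hF]; ring
    _ = ∑' (k : ℕ) (n : ℤ), F k n := hFs.tsum_comm
    _ = ∑' k : ℕ, (Complex.I * (z + z⁻¹ - 2)) ^ k / (k ! : ℂ) * laurentSum a z :=
        tsum_congr fun k => by
          rw [hF, tsum_mul_left]
          change _ * laurentSum (discreteLaplacian^[k] a) z = _
          rw [(hit k).2.2, mul_pow]; ring
    _ = _ := by
        rw [tsum_mul_right, Complex.exp_eq_exp_ℂ, (NormedSpace.expSeries_div_hasSum_exp _).tsum_eq]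

end Laplacian

/-- Decay of a bilateral sequence at the rate `1 / (2 ^ |n| |n|!)`. -/
def HasFactorialDecay (a : ℤ → ℂ) (K : ℝ) : Prop :=
  ∀ n : ℤ, ‖a n‖ ≤ K * (2 ^ n.natAbs * (n.natAbs ! : ℝ))⁻¹

lemma hasSum_nat_inv_two_pow_mul_factorial (r : ℝ) :
    HasSum (fun n : ℕ => (2 ^ n * (n ! : ℝ))⁻¹ * r ^ n) (Real.exp (r / 2)) := by
  have h := NormedSpace.expSeries_div_hasSum_exp (r / 2)
  rw [← Real.exp_eq_exp_ℝ] at h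
  have heq (n : ℕ) : (2 ^ n * (n ! : ℝ))⁻¹ * r ^ n = (r / 2) ^ n / (n ! : ℝ) := by
    rw [div_pow, mul_inv]; ring
  simpa only [heq] using h

lemma hasSum_nat_succ_inv_two_pow_mul_factorial (r : ℝ) :
    HasSum (fun n : ℕ => (2 ^ (n + 1) * ((n + 1)! : ℝ))⁻¹ * r ^ (n + 1)) (Real.exp (r / 2) - 1) := by
  rw [hasSum_nat_add_iff (f := fun n : ℕ => (2 ^ n * (n ! : ℝ))⁻¹ * r ^ n) 1]
  simpa using hasSum_nat_inv_two_pow_mul_factorial r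

lemma hasSum_int_inv_two_pow_mul_factorial (r : ℝ) :
    HasSum (fun n : ℤ => (2 ^ n.natAbs * (n.natAbs ! : ℝ))⁻¹ * r ^ n)
      (Real.exp (r / 2) + (Real.exp (r⁻¹ / 2) - 1)) := by
  refine HasSum.of_nat_of_neg_add_one ?_ ?_
  · simpa using hasSum_nat_inv_two_pow_mul_factorial r
  · convert hasSum_nat_succ_inv_two_pow_mul_factorial r⁻¹ using 2 with n
    rw [Int.natAbs_neg, inv_pow, zpow_neg]
    norm_cast

namespace HasFactorialDecay

variable {a : ℤ → ℂ} {K : ℝ} {z : ℂ}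

lemma nonneg (ha : HasFactorialDecay a K) : 0 ≤ K := by
  simpa using (norm_nonneg _).trans (ha 0)

lemma mono {L : ℝ} (ha : HasFactorialDecay a K) (h : K ≤ L) : HasFactorialDecay a L := fun n =>
  (ha n).trans (mul_le_mul_of_nonneg_right h (by positivity))

lemma comp_neg (ha : HasFactorialDecay a K) : HasFactorialDecay (fun n => a (-n)) K := fun n => by
  simpa using ha (-n)

lemma norm_mul_zpow_le (ha : HasFactorialDecay a K) (z : ℂ) (n : ℤ) :
    ‖a n * z ^ n‖ ≤ K * ((2 ^ n.natAbs * (n.natAbs ! : ℝ))⁻¹ * ‖z‖ ^ n) := by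
  rw [norm_mul, norm_zpow, ← mul_assoc]
  exact mul_le_mul_of_nonneg_right (ha n) (by positivity)

lemma summable_norm (ha : HasFactorialDecay a K) (z : ℂ) :
    Summable fun n : ℤ => ‖a n * z ^ n‖ :=
  .of_nonneg_of_le (fun _ => norm_nonneg _) (ha.norm_mul_zpow_le z)
    ((hasSum_int_inv_two_pow_mul_factorial ‖z‖).summable.mul_left K)

lemma norm_laurentSum_le (ha : HasFactorialDecay a K) (z : ℂ) :
    ‖laurentSum a z‖ ≤ K * (Real.exp (‖z‖ / 2) + (Real.exp (‖z‖⁻¹ / 2) - 1)) :=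
  tsum_of_norm_bounded ((hasSum_int_inv_two_pow_mul_factorial ‖z‖).mul_left K)
    (ha.norm_mul_zpow_le z)

lemma norm_laurentSum_le_of_one_le (ha : HasFactorialDecay a K) (hz : 1 ≤ ‖z‖) :
    ‖laurentSum a z‖ ≤ 2 * K * Real.exp (‖z‖ / 2) := by
  have h1 : Real.exp (‖z‖⁻¹ / 2) ≤ Real.exp (‖z‖ / 2) := by
    gcongr
    exact (inv_le_one_of_one_le₀ hz).trans hz
  nlinarith [ha.norm_laurentSum_le z, ha.nonneg]

lemma differentiableAt_laurentSum (ha : HasFactorialDecay a K) (hz : z ≠ 0) :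
    DifferentiableAt ℂ (laurentSum a) z := by
  set r := ‖z‖ / 2 with hr
  set R := 2 * ‖z‖ with hR
  have hz' : 0 < ‖z‖ := norm_pos_iff.2 hz
  have hr0 : 0 < r := by positivity
  set U : Set ℂ := {w | r < ‖w‖ ∧ ‖w‖ < R} with hU
  have hUo : IsOpen U := by
    rw [hU, Set.ofPred_and]
    exact (isOpen_lt continuous_const continuous_norm).inter
      (isOpen_lt continuous_norm continuous_const)
  have hzU : z ∈ U := ⟨by linarith, by linarith⟩
  have hs : Summable fun n : ℤ => K * ((2 ^ n.natAbs * (n.natAbs ! : ℝ))⁻¹ * R ^ n)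
      + K * ((2 ^ n.natAbs * (n.natAbs ! : ℝ))⁻¹ * r ^ n) :=
    ((hasSum_int_inv_two_pow_mul_factorial R).summable.mul_left K).add
      ((hasSum_int_inv_two_pow_mul_factorial r).summable.mul_left K)
  refine (Complex.differentiableOn_tsum_of_summable_norm hs (fun n w hw => ?_) hUo
    (fun n w hw => (ha.norm_mul_zpow_le w n).trans ?_)).differentiableAt (hUo.mem_nhds hzU)
  · have hw0 : w ≠ 0 := norm_pos_iff.1 (hr0.trans hw.1)
    exact ((differentiableAt_zpow.2 (Or.inl hw0)).const_mul _).differentiableWithinAt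
  · have hK := ha.nonneg
    have hw0 : 0 < ‖w‖ := hr0.trans hw.1
    have hR0 : 0 < R := hw0.trans hw.2
    -- On the annulus the outer radius controls `n ≥ 0` and the inner one `n ≤ 0`; the sum covers
    -- both signs.
    have hle : ‖w‖ ^ n ≤ R ^ n + r ^ n := by
      rcases le_total 0 n with hn | hn
      · exact (zpow_le_zpow_left₀ hn hw0.le hw.2.le).trans (le_add_of_nonneg_right (by positivity))
      · refine le_trans ?_ (le_add_of_nonneg_left (by positivity))
        rw [← inv_le_inv₀ (by positivity) (by positivity), ← zpow_neg, ← zpow_neg]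
        exact zpow_le_zpow_left₀ (by lia) hr0.le hw.1.le
    rw [← mul_add, ← mul_add]
    gcongr

end HasFactorialDecay

end LaurentSum

/-! ### Boundedness at infinity and Liouville's theorem. -/

section Bounded

open Complex

/-- A function on `ℂ \ {0}` of size `exp ((|z| - |Im z|) / 2)` at infinity is bounded there. -/
lemma exists_norm_le_of_norm_le_exp {f : ℂ → ℂ} {M : ℝ}
    (hd : ∀ z, z ≠ 0 → DifferentiableAt ℂ f z)
    (hf : ∀ z : ℂ, 1 ≤ ‖z‖ → ‖f z‖ ≤ M * Real.exp ((‖z‖ - |z.im|) / 2)) :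
    ∃ B, ∀ z : ℂ, 1 ≤ ‖z‖ → ‖f z‖ ≤ B := by
  have hM : 0 ≤ M := by
    have h := (norm_nonneg _).trans (hf 1 (by simp))
    exact nonneg_of_mul_nonneg_left h (Real.exp_pos _)
  have half (σ : ℂ) (hσ : σ = 1 ∨ σ = -1) (z : ℂ) (hz : 1 ≤ z.re) :
      ‖f (σ * z)‖ ≤ M * Real.exp (1 / 2) := by
    have hσn : ‖σ‖ = 1 := by rcases hσ with rfl | rfl <;> simp
    have hσ0 : σ ≠ 0 := norm_ne_zero_iff.1 (by simp [hσn])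
    have him (w : ℂ) : |(σ * w).im| = |w.im| := by rcases hσ with rfl | rfl <;> simp
    have hnorm (w : ℂ) (hw : 0 ≤ w.re) : 1 ≤ ‖w + 1‖ := by
      refine le_trans ?_ (re_le_norm _)
      simpa using hw
    -- The shift by `1` keeps the closed half-plane away from the singularity at `0` and costs a
    -- factor `exp (1 / 2)`.
    have h := norm_le_of_norm_le_exp_norm_sub_abs_im (g := fun w => f (σ * (w + 1)))
      (M := M * Real.exp (1 / 2)) (z := z - 1) ?_ ?_ (by simpa using hz)
    · simpa using h
    · refine DifferentiableOn.diffContOnCl fun w hw => ?_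
      rw [closure_setOfPred_lt_re] at hw
      have hne : σ * (w + 1) ≠ 0 :=
        mul_ne_zero hσ0 (norm_pos_iff.1 (one_pos.trans_le (hnorm w hw)))
      exact ((hd _ hne).comp w (by fun_prop)).differentiableWithinAt
    · intro w hw
      refine (hf _ (by rw [norm_mul, hσn, one_mul]; exact hnorm w hw)).trans ?_
      rw [mul_assoc, ← Real.exp_add, him, norm_mul, hσn]
      gcongr
      have := norm_add_le w 1
      rw [norm_one] at this
      simp only [add_im, one_im, add_zero]
      linarith
  refine ⟨M * Real.exp (1 / 2), fun z hz => ?_⟩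
  rcases le_total 1 z.re with h | h
  · simpa using half 1 (Or.inl rfl) z h
  rcases le_total z.re (-1) with h' | h'
  · simpa using half (-1) (Or.inr rfl) (-z) (by simp; linarith)
  -- In the remaining strip `‖z‖ - |z.im| ≤ |z.re| ≤ 1`.
  · refine (hf z hz).trans ?_
    gcongr
    have h1 := norm_le_abs_re_add_abs_im z
    have h2 : |z.re| ≤ 1 := abs_le.2 ⟨h', h⟩
    linarith

/-- Liouville's theorem on the punctured plane. -/
lemma eq_of_bounded_punctured_plane {f : ℂ → ℂ} {B : ℝ}
    (hd : ∀ z, z ≠ 0 → DifferentiableAt ℂ f z) (hf : ∀ z, z ≠ 0 → ‖f z‖ ≤ B)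
    {z w : ℂ} (hz : z ≠ 0) (hw : w ≠ 0) : f z = f w := by
  have hF := differentiableOn_update_limUnder_of_bddAbove (f := f) (c := 0) (s := Set.univ)
    univ_mem (fun z hz => (hd z hz.2).differentiableWithinAt)
    ⟨B, by rintro _ ⟨z, hz, rfl⟩; exact hf z hz.2⟩
  rw [differentiableOn_univ] at hF
  set F := Function.update f 0 (limUnder (𝓝[≠] 0) f) with hFdef
  have hFf (z : ℂ) (hz : z ≠ 0) : F z = f z := Function.update_of_ne hz _ _
  have hb : Bornology.IsBounded (Set.range F) := by
    refine (isBounded_iff_forall_norm_le).2 ⟨max B ‖F 0‖, ?_⟩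
    rintro _ ⟨z, rfl⟩
    by_cases hz : z = 0
    · rw [hz]; exact le_max_right _ _
    · rw [hFf z hz]; exact (hf z hz).trans (le_max_left _ _)
  rw [← hFf z hz, ← hFf w hw]
  exact hF.apply_eq_apply_of_bounded hb z w

end Bounded

/-! ### Rigidity of the symmetrized generating function. -/

section Uniqueness

open Complex
open scoped Nat

variable {a b : ℤ → ℂ} {K : ℝ}

lemma re_I_mul_add_inv_div_two (z : ℂ) :
    (I * (z + z⁻¹) / 2).re = -(z.im + z⁻¹.im) / 2 := by
  simp

lemma differentiableAt_exp_mul_laurentSum (ha : HasFactorialDecay a K) {z : ℂ} (hz : z ≠ 0) :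
    DifferentiableAt ℂ (fun z => exp (I * (z + z⁻¹) / 2) * laurentSum a z) z := by
  have := ha.differentiableAt_laurentSum hz
  fun_prop (disch := assumption)

/-- The half-power of the propagator sits midway between the two times: its modulus gains `exp
(-|z.im| / 2)` against `a` above the real axis and against `b` below it. The extra `exp (1 / 2)` in
the constant absorbs the `z⁻¹` term. -/
lemma exists_norm_exp_mul_laurentSum_le (ha : HasFactorialDecay a K) (hb : HasFactorialDecay b K)
    (hab : ∀ z : ℂ, z ≠ 0 →
      laurentSum b z = exp (I * (z + z⁻¹ - 2)) * laurentSum a z) :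
    ∃ B, ∀ z : ℂ, 1 ≤ ‖z‖ → ‖exp (I * (z + z⁻¹) / 2) * laurentSum a z‖ ≤ B := by
  refine exists_norm_le_of_norm_le_exp (M := 2 * K * Real.exp (1 / 2))
    (fun z hz => differentiableAt_exp_mul_laurentSum ha hz) fun z hz => ?_
  have hz0 : z ≠ 0 := norm_pos_iff.1 (one_pos.trans_le hz)
  have hK := ha.nonneg
  have hinv : |z⁻¹.im| ≤ 1 :=
    (abs_im_le_norm _).trans (by rw [norm_inv]; exact inv_le_one_of_one_le₀ hz)
  obtain ⟨h1, h2⟩ := abs_le.1 hinv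
  rcases le_total 0 z.im with h | h
  · rw [norm_mul, norm_exp, re_I_mul_add_inv_div_two, abs_of_nonneg h]
    refine (mul_le_mul_of_nonneg_left (ha.norm_laurentSum_le_of_one_le hz)
      (Real.exp_pos _).le).trans ?_
    rw [mul_left_comm, ← Real.exp_add, mul_assoc (2 * K), ← Real.exp_add]
    refine mul_le_mul_of_nonneg_left (Real.exp_le_exp.2 ?_) (by positivity)
    linarith
  · have heq : exp (I * (z + z⁻¹) / 2) * laurentSum a z
        = exp (2 * I) * (exp (-(I * (z + z⁻¹) / 2)) * laurentSum b z) := by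
      rw [hab z hz0, ← mul_assoc, ← mul_assoc, ← exp_add, ← exp_add]
      congr 2
      ring
    rw [heq, norm_mul, norm_exp, norm_mul, norm_exp, neg_re, re_I_mul_add_inv_div_two,
      abs_of_nonpos h]
    refine (mul_le_mul_of_nonneg_left (mul_le_mul_of_nonneg_left
      (hb.norm_laurentSum_le_of_one_le hz) (Real.exp_pos _).le) (Real.exp_pos _).le).trans ?_
    rw [mul_left_comm (Real.exp _) (2 * K), mul_left_comm, ← Real.exp_add, ← Real.exp_add,
      mul_assoc (2 * K), ← Real.exp_add]
    refine mul_le_mul_of_nonneg_left (Real.exp_le_exp.2 ?_) (by positivity)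
    rw [mul_comm 2 I, I_mul_re, im_ofNat]
    linarith

/-- The symmetrized generating function is constant. -/
theorem exists_exp_mul_laurentSum_eq (ha : HasFactorialDecay a K) (hb : HasFactorialDecay b K)
    (hab : ∀ z : ℂ, z ≠ 0 →
      laurentSum b z = exp (I * (z + z⁻¹ - 2)) * laurentSum a z) :
    ∃ c, ∀ z : ℂ, z ≠ 0 → exp (I * (z + z⁻¹) / 2) * laurentSum a z = c := by
  obtain ⟨B, hB⟩ := exists_norm_exp_mul_laurentSum_le ha hb hab
  -- Reflecting the sequences replaces `z` by `z⁻¹`, under which the multiplier is invariant; this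
  -- bounds the punctured disc.
  obtain ⟨B', hB'⟩ := exists_norm_exp_mul_laurentSum_le ha.comp_neg hb.comp_neg fun z hz => by
    rw [laurentSum_comp_neg, laurentSum_comp_neg, hab _ (inv_ne_zero hz), inv_inv, add_comm z]
  refine ⟨_, fun z hz => eq_of_bounded_punctured_plane (B := max B B')
    (fun z hz => differentiableAt_exp_mul_laurentSum ha hz) (fun z hz => ?_) hz one_ne_zero⟩
  rcases le_total 1 ‖z‖ with h | h
  · exact (hB z h).trans (le_max_left _ _)
  · refine le_trans ?_ (le_max_right _ _)
    have h1 := hB' z⁻¹ (by rw [norm_inv]; exact one_le_inv₀ (norm_pos_iff.2 hz) |>.2 h)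
    rwa [laurentSum_comp_neg, inv_inv, add_comm z⁻¹] at h1

/-- The tail is dominated by `δ` times the exponential series, the first `N` terms by a polynomial,
and the negative indices by a constant because `‖z‖⁻¹ ≤ 1`. Only the first piece has size `exp (‖z‖
/ 2)`. -/
lemma norm_laurentSum_le_of_tail (ha : HasFactorialDecay a K) {δ : ℝ} (hδ : 0 ≤ δ) {N : ℕ}
    (hN : ∀ n : ℕ, N ≤ n → ‖a n‖ * (2 ^ n * (n ! : ℝ)) ≤ δ) {z : ℂ} (hz : 1 ≤ ‖z‖) :
    ‖laurentSum a z‖ ≤ δ * Real.exp (‖z‖ / 2)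
      + (∑ n ∈ Finset.range N, K * ‖z‖ ^ n + K * (Real.exp (1 / 2) - 1)) := by
  have hK := ha.nonneg
  have hb1 : HasSum (fun n : ℕ => δ * ((2 ^ n * (n ! : ℝ))⁻¹ * ‖z‖ ^ n)
      + if n ∈ Finset.range N then K * ‖z‖ ^ n else 0)
      (δ * Real.exp (‖z‖ / 2) + ∑ n ∈ Finset.range N, K * ‖z‖ ^ n) := by
    refine ((hasSum_nat_inv_two_pow_mul_factorial ‖z‖).mul_left _).add ?_
    have h : HasSum (fun n => if n ∈ Finset.range N then K * ‖z‖ ^ n else 0)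
        (∑ n ∈ Finset.range N, if n ∈ Finset.range N then K * ‖z‖ ^ n else 0) :=
      hasSum_sum_of_ne_finset_zero fun n hn => if_neg hn
    rwa [Finset.sum_congr rfl fun n hn => if_pos hn] at h
  have hb2 := (hasSum_nat_succ_inv_two_pow_mul_factorial ‖z‖⁻¹).mul_left K
  have hs := ha.summable_norm z
  have hs1 : Summable fun n : ℕ => a n * z ^ (n : ℤ) :=
    hs.of_norm.comp_injective Nat.cast_injective
  have hs2 : Summable fun n : ℕ => a (-(n + 1)) * z ^ (-(n + 1) : ℤ) :=
    hs.of_norm.comp_injective (i := fun n : ℕ => (-(n + 1) : ℤ)) fun m n h => by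
      simpa using h
  have hsum : laurentSum a z = ∑' n : ℕ, a n * z ^ (n : ℤ)
      + ∑' n : ℕ, a (-(n + 1)) * z ^ (-(n + 1) : ℤ) :=
    (HasSum.of_nat_of_neg_add_one (f := fun n : ℤ => a n * z ^ n) hs1.hasSum hs2.hasSum).tsum_eq
  have hle1 := tsum_of_norm_bounded (f := fun n : ℕ => a n * z ^ (n : ℤ)) hb1 fun n => by
    have hw : 0 < (2 ^ n * (n ! : ℝ)) := by positivity
    rw [norm_mul, norm_zpow, zpow_natCast, ← mul_assoc]
    by_cases hnN : n < N
    · rw [if_pos (Finset.mem_range.2 hnN)]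
      have hw1 : 1 ≤ (2 ^ n * (n ! : ℝ)) :=
        one_le_mul_of_one_le_of_one_le (one_le_pow₀ one_le_two)
          (by exact_mod_cast n.factorial_pos)
      have h1 : ‖a n‖ ≤ K := (ha n).trans <| mul_le_of_le_one_right hK <| by
        simpa using inv_le_one_of_one_le₀ hw1
      have h2 : 0 ≤ δ * (2 ^ n * (n ! : ℝ))⁻¹ * ‖z‖ ^ n := by positivity
      have h3 := mul_le_mul_of_nonneg_right h1 (pow_nonneg (norm_nonneg z) n)
      linarith
    · rw [if_neg (by simpa using hnN), add_zero, ← div_eq_mul_inv]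
      gcongr
      rw [le_div_iff₀ hw]
      exact hN n (not_lt.1 hnN)
  have hle2 := tsum_of_norm_bounded
    (f := fun n : ℕ => a (-(n + 1)) * z ^ (-(n + 1) : ℤ)) hb2 fun n => by
      have h := ha.norm_mul_zpow_le z (-(n + 1))
      rw [Int.natAbs_neg, zpow_neg ‖z‖] at h
      rw [inv_pow]
      exact_mod_cast h
  have hyi : Real.exp (‖z‖⁻¹ / 2) ≤ Real.exp (1 / 2) :=
    Real.exp_le_exp.2 (by linarith [inv_le_one_of_one_le₀ hz])
  rw [hsum]
  refine (norm_add_le _ _).trans ((add_le_add hle1 hle2).trans ?_)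
  have := mul_le_mul_of_nonneg_left hyi hK
  linarith

lemma tendsto_polynomial_mul_exp_neg_half (K c : ℝ) (N : ℕ) :
    Tendsto (fun y : ℝ => (∑ n ∈ Finset.range N, K * y ^ n + c) * Real.exp (-(y / 2)))
      atTop (𝓝 0) := by
  have h1 (n : ℕ) : Tendsto (fun y : ℝ => y ^ n * Real.exp (-(y / 2))) atTop (𝓝 0) := by
    have := ((Real.tendsto_pow_mul_exp_neg_atTop_nhds_zero n).comp
      (tendsto_id.atTop_div_const (two_pos (α := ℝ)))).const_mul (2 ^ n)
    rw [mul_zero] at this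
    refine this.congr fun y => ?_
    simp only [Function.comp, id, div_pow]
    field_simp
  have h2 := tendsto_finsetSum (Finset.range N) fun n _ => (h1 n).const_mul K
  have h3 := h2.add ((h1 0).const_mul c)
  simp only [mul_zero, Finset.sum_const_zero, add_zero, pow_zero, one_mul] at h3
  refine h3.congr fun y => ?_
  rw [add_mul, Finset.sum_mul]
  simp only [mul_assoc]

/-- If the coefficients decay faster than `1 / (2 ^ n n!)` at `+∞`, then the generating function is
`o(exp (|z| / 2))`. -/
theorem tendsto_norm_laurentSum_mul_exp (ha : HasFactorialDecay a K)
    (hlim : Tendsto (fun n : ℕ => ‖a n‖ * (2 ^ n * (n ! : ℝ))) atTop (𝓝 0)) :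
    Tendsto (fun y : ℝ => ‖laurentSum a (y * I)‖ * Real.exp (-(y / 2))) atTop (𝓝 0) := by
  refine tendsto_order.2 ⟨fun ε hε => .of_forall fun y => hε.trans_le (by positivity),
    fun ε hε => ?_⟩
  obtain ⟨N, hN⟩ := (hlim.eventually_lt_const (half_pos hε)).exists_forall_of_atTop
  filter_upwards [(tendsto_polynomial_mul_exp_neg_half K
    (K * (Real.exp (1 / 2) - 1)) N).eventually_lt_const (half_pos hε), eventually_ge_atTop 1]
    with y hy hy1
  have hn : ‖(y * I : ℂ)‖ = y := by simp [abs_of_nonneg (zero_le_one.trans hy1)]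
  have hle := norm_laurentSum_le_of_tail ha (half_pos hε).le (fun n h => (hN n h).le)
    (z := y * I) (by rwa [hn])
  rw [hn] at hle
  have hfin := mul_le_mul_of_nonneg_right hle (Real.exp_pos (-(y / 2))).le
  rw [add_mul, mul_assoc, ← Real.exp_add, add_neg_cancel, Real.exp_zero, mul_one] at hfin
  linarith

lemma laurentSum_eq_zero_of_tendsto (ha : HasFactorialDecay a K) (hb : HasFactorialDecay b K)
    (hab : ∀ z : ℂ, z ≠ 0 →
      laurentSum b z = exp (I * (z + z⁻¹ - 2)) * laurentSum a z)
    (hlim : Tendsto (fun n : ℕ => ‖a n‖ * (2 ^ n * (n ! : ℝ))) atTop (𝓝 0)) {z : ℂ}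
    (hz : z ≠ 0) : laurentSum a z = 0 := by
  obtain ⟨c, hc⟩ := exists_exp_mul_laurentSum_eq ha hb hab
  have hc0 : c = 0 := by
    -- At `z = iy` the multiplier has modulus `exp (-(y - y⁻¹) / 2)`, at most `exp (1 / 2) * exp
    -- (-(y / 2))` for `y ≥ 1`.
    have h0 := (tendsto_norm_laurentSum_mul_exp ha hlim).const_mul (Real.exp (1 / 2))
    rw [mul_zero] at h0
    refine norm_le_zero_iff.1 (ge_of_tendsto h0 ((eventually_ge_atTop 1).mono fun y hy => ?_))
    have hy0 : (y : ℂ) ≠ 0 := ofReal_ne_zero.2 (by linarith)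
    rw [← hc (y * I) (mul_ne_zero hy0 I_ne_zero), norm_mul, norm_exp, re_I_mul_add_inv_div_two,
      mul_left_comm, ← Real.exp_add, mul_comm]
    gcongr
    have h1 : (y * I : ℂ)⁻¹.im = -y⁻¹ := by
      rw [mul_inv, inv_I, ← ofReal_inv, im_ofReal_mul]; simp
    have h2 : y⁻¹ ≤ 1 := inv_le_one_of_one_le₀ hy
    rw [h1, im_ofReal_mul, I_im]
    linarith
  have := hc z hz
  rw [hc0] at this
  exact (mul_eq_zero.1 this).resolve_left (exp_ne_zero _)

/-- A bilateral series with summable coefficients that vanishes on the unit circle is zero. -/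
lemma eq_zero_of_laurentSum_eq_zero (ha : Summable fun n => ‖a n‖)
    (h0 : ∀ z : ℂ, ‖z‖ = 1 → laurentSum a z = 0) : a = 0 := by
  have : Fact (0 < (1 : ℝ)) := ⟨one_pos⟩
  have hs : Summable fun n : ℤ => a n • (fourier n : C(AddCircle (1 : ℝ), ℂ)) := by
    refine Summable.of_norm (ha.congr fun n => ?_)
    rw [norm_smul, fourier_norm, mul_one]
  have hS : ∑' n : ℤ, a n • (fourier n : C(AddCircle (1 : ℝ), ℂ)) = 0 := by
    ext x
    rw [← ContinuousMap.tsum_apply hs, ContinuousMap.zero_apply, ← h0 _ x.toCircle.norm_coe]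
    exact tsum_congr fun n => by simp [fourier_apply, AddCircle.toCircle_zsmul]
  have h2 := hs.hasSum
  rw [hS] at h2
  funext m
  have h3 := (ContinuousMap.toLp 2 AddCircle.haarAddCircle ℂ (E := ℂ)).hasSum h2
  -- Pairing the vanishing series with the `m`-th character isolates `a m` by orthonormality.
  have h4 := (innerSL ℂ (fourierLp (T := 1) 2 m)).hasSum h3
  have h5 (n : ℤ) : innerSL ℂ (fourierLp (T := 1) 2 m)
      (ContinuousMap.toLp 2 AddCircle.haarAddCircle ℂ (a n • fourier n))
      = if n = m then a m else 0 := by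
    rw [map_smul, innerSL_apply_apply, inner_smul_right]
    change a n * inner ℂ (fourierLp 2 m) (fourierLp 2 n) = _
    rw [orthonormal_iff_ite.1 orthonormal_fourier]
    rcases eq_or_ne n m with rfl | h
    · simp
    · simp [h, h.symm]
  simp only [h5, map_zero] at h4
  exact (h4.unique (hasSum_ite_eq m (a m))).symm

theorem eq_zero_of_tendsto (ha : HasFactorialDecay a K) (hb : HasFactorialDecay b K)
    (hab : ∀ z : ℂ, z ≠ 0 →
      laurentSum b z = exp (I * (z + z⁻¹ - 2)) * laurentSum a z)
    (hlim : Tendsto (fun n : ℕ => ‖a n‖ * (2 ^ n * (n ! : ℝ))) atTop (𝓝 0)) : a = 0 := by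
  refine eq_zero_of_laurentSum_eq_zero (by simpa using ha.summable_norm 1) fun z hz => ?_
  exact laurentSum_eq_zero_of_tendsto ha hb hab hlim (norm_ne_zero_iff.1 (by simp [hz]))

theorem eq_zero_of_tendsto_neg (ha : HasFactorialDecay a K) (hb : HasFactorialDecay b K)
    (hab : ∀ z : ℂ, z ≠ 0 →
      laurentSum b z = exp (I * (z + z⁻¹ - 2)) * laurentSum a z)
    (hlim : Tendsto (fun n : ℕ => ‖a (-n)‖ * (2 ^ n * (n ! : ℝ))) atTop (𝓝 0)) : a = 0 := by
  have hneg : (fun n => a (-n)) = 0 :=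
    eq_zero_of_tendsto ha.comp_neg hb.comp_neg (fun z hz => by
      rw [laurentSum_comp_neg, laurentSum_comp_neg, hab _ (inv_ne_zero hz), inv_inv,
        add_comm z]) hlim
  funext n
  simpa using congrFun hneg (-n)

end Uniqueness

/-! ### Stirling's formula and the factorial form of the hypotheses. -/

section Stirling

open scoped Nat

lemma two_pow_mul_factorial_eq_stirlingSeq {n : ℕ} (hn : n ≠ 0) :
    2 ^ n * (n ! : ℝ) =
      √2 * Stirling.stirlingSeq n * ((2 * n / Real.exp 1) ^ n * √n) := by
  have hn' : (0 : ℝ) < n := by positivity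
  rw [Stirling.stirlingSeq, Real.sqrt_mul zero_le_two, mul_div_assoc 2 (n : ℝ), mul_pow]
  field_simp

lemma stirlingSeq_le_one {n : ℕ} (hn : n ≠ 0) :
    Stirling.stirlingSeq n ≤ Stirling.stirlingSeq 1 := by
  obtain ⟨m, rfl⟩ := Nat.exists_eq_succ_of_ne_zero hn
  exact Stirling.stirlingSeq'_antitone (Nat.zero_le m)

/-- Only this side of Stirling is needed, and it follows from monotonicity of `stirlingSeq`, without
its limit. -/
lemma exists_two_pow_mul_factorial_le :
    ∃ D : ℝ, 0 < D ∧ ∀ n : ℕ, n ≠ 0 →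
      2 ^ n * (n ! : ℝ) ≤ D * ((2 * n / Real.exp 1) ^ n * √n) := by
  refine ⟨√2 * Stirling.stirlingSeq 1,
    mul_pos (by positivity) (Stirling.stirlingSeq'_pos 0), fun n hn => ?_⟩
  rw [two_pow_mul_factorial_eq_stirlingSeq hn]
  gcongr
  exact stirlingSeq_le_one hn

lemma exists_hasFactorialDecay {a : ℤ → ℂ} {C : ℝ} (hC : 0 < C)
    (ha : ∀ n : ℤ, n ≠ 0 →
      ‖a n‖ ≤ C * (1 / √|(n : ℝ)|) * (Real.exp 1 / (2 * |(n : ℝ)|)) ^ n.natAbs) :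
    ∃ K, HasFactorialDecay a K := by
  obtain ⟨D, hD, h⟩ := exists_two_pow_mul_factorial_le
  -- The hypothesis is silent at `n = 0`, where the weight is `1`; hence `‖a 0‖` in the maximum.
  refine ⟨max (C * D) ‖a 0‖, fun n => ?_⟩
  rcases eq_or_ne n 0 with rfl | hn
  · simp
  have hn' : n.natAbs ≠ 0 := Int.natAbs_ne_zero.2 hn
  have hpos : (0 : ℝ) < n.natAbs := by positivity
  refine (ha n hn).trans ?_
  rw [← Int.cast_abs, Int.abs_eq_natAbs, Int.cast_natCast, ← div_eq_mul_inv,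
    le_div_iff₀ (by positivity)]
  refine le_trans ?_ (le_max_left _ _)
  refine (mul_le_mul_of_nonneg_left (h _ hn') (by positivity)).trans_eq ?_
  rw [← inv_div (2 * (n.natAbs : ℝ)), inv_pow]
  field_simp

lemma tendsto_mul_two_pow_mul_factorial {a : ℤ → ℂ}
    (ha : Tendsto (fun n : ℕ => ‖a n‖ * (2 * n / Real.exp 1) ^ n * √n) atTop (𝓝 0)) :
    Tendsto (fun n : ℕ => ‖a n‖ * (2 ^ n * (n ! : ℝ))) atTop (𝓝 0) := by
  obtain ⟨D, hD, h⟩ := exists_two_pow_mul_factorial_le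
  have h0 := ha.const_mul D
  rw [mul_zero] at h0
  refine squeeze_zero' (.of_forall fun n => by positivity) ?_ h0
  filter_upwards [eventually_ne_atTop 0] with n hn
  refine (mul_le_mul_of_nonneg_left (h n hn) (norm_nonneg _)).trans_eq (by ring)

end Stirling

/-! ### Conclusion for solutions. -/

theorem IsFreeSchrodingerSolution.eq_zero_of_initial_eq_zero {u : ℝ → EllTwoZ}
    (hu : IsFreeSchrodingerSolution u) (h0 : (u 0 : ℤ → ℂ) = 0) {t : ℝ}
    (ht : t ∈ Set.Icc (0 : ℝ) 1) : u t = 0 := by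
  have h : u 0 = 0 := lp.ext h0
  rw [hu.eq_exp_apply ht, h, map_zero]

theorem mainTheorem4
    (u : ℝ → EllTwoZ) (hu : IsFreeSchrodingerSolution u)
    (C : ℝ) (hC : 0 < C)
    (h0 : ∀ n : ℤ, n ≠ 0 →
      ‖u 0 n‖ ≤ C * (1 / √|(n : ℝ)|) * (Real.exp 1 / (2 * |(n : ℝ)|)) ^ n.natAbs)
    (h1 : ∀ n : ℤ, n ≠ 0 →
      ‖u 1 n‖ ≤ C * (1 / √|(n : ℝ)|) * (Real.exp 1 / (2 * |(n : ℝ)|)) ^ n.natAbs)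
    (hdecay :
      (fun n : ℤ => ‖u 0 n‖ * (2 * |(n : ℝ)| / Real.exp 1) ^ n.natAbs * √|(n : ℝ)|)
          =o[atTop] (fun _ : ℤ => (1 : ℝ)) ∨
      (fun n : ℤ => ‖u 0 n‖ * (2 * |(n : ℝ)| / Real.exp 1) ^ n.natAbs * √|(n : ℝ)|)
          =o[atBot] (fun _ : ℤ => (1 : ℝ))) :
    ∀ t ∈ Set.Icc (0 : ℝ) 1, ∀ n : ℤ, u t n = 0 := by
  obtain ⟨K₀, hK₀⟩ := exists_hasFactorialDecay hC h0
  obtain ⟨K₁, hK₁⟩ := exists_hasFactorialDecay hC h1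
  have ha : HasFactorialDecay (u 0) (max K₀ K₁) := hK₀.mono (le_max_left _ _)
  have hb : HasFactorialDecay (u 1) (max K₀ K₁) := hK₁.mono (le_max_right _ _)
  have hab (z : ℂ) (hz : z ≠ 0) : laurentSum (u 1) z
      = Complex.exp (Complex.I * (z + z⁻¹ - 2)) * laurentSum (u 0) z :=
    laurentSum_eq_exp_mul hu.hasSum_apply hz (ha.summable_norm z)
  have hzero : (u 0 : ℤ → ℂ) = 0 := by
    simp only [isLittleO_one_iff] at hdecay
    rcases hdecay with h | h
    · refine eq_zero_of_tendsto ha hb hab (tendsto_mul_two_pow_mul_factorial ?_)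
      simpa [Function.comp_def] using h.comp tendsto_natCast_atTop_atTop
    · refine eq_zero_of_tendsto_neg ha hb hab
        (tendsto_mul_two_pow_mul_factorial (a := fun n => u 0 (-n)) ?_)
      simpa [Function.comp_def] using
        h.comp (tendsto_neg_atTop_atBot.comp tendsto_natCast_atTop_atTop)
  intro t ht n
  rw [hu.eq_zero_of_initial_eq_zero hzero ht]
  rfl
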